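/- Let $X$ be a finite set with a Markov transition kernel $m^X_\bullet$ and a stationary probability distribution $\mu_X$; call $\mathcal X=(X,m^X_\bullet,\mu_X)$ a measure Markov chain. Let $\mathcal Y=(Y,m^Y_\bullet,\mu_Y)$ be another one, and let $\ell_X:X\to Z$, $\ell_Y:Y\to Z$ be maps to a metric space $Z$. For a metric space $W$ let $\mathcal P(W)$ be the set of Borel probability measures on $W$ with finite first moment, with the Wasserstein distance $d_{\mathrm W}(\alpha,\beta)=\inf_\pi\int d_W(w,w')\,\pi(dw\times dw')$, the infimum being over all couplings $\pi$ of $\alpha$ and $\beta$ (probability measures on $W\times W$ with marginals $\alpha,\beta$). Put $\mathcal P^{\circ 0}(Z)=Z$ and $\mathcal P^{\circ(k+1)}(Z)=\mathcal P(\mathcal P^{\circ k}(Z))$. Define $\mathfrak l^{(k)}_{X}:X\to\mathcal P^{\circ k}(Z)$ by $\mathfrak l^{(0)}_X=\ell_X$ and $\mathfrak l^{(k+1)}_X(x)=(\mathfrak l^{(k)}_X)_\# m^X_x$, put $\mathfrak L_k(\mathcal X,\ell_X)=(\mathfrak l^{(k)}_X)_\#\mu_X\in\mathcal P^{\circ(k+1)}(Z)$,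 and likewise for $\mathcal Y$. The Weisfeiler-Lehman distance of depth $k$ is $$d^{(k)}_{\mathrm{WL}}\big((\mathcal X,\ell_X),(\mathcal Y,\ell_Y)\big)=d_{\mathrm W}\big(\mathfrak L_k(\mathcal X,\ell_X),\mathfrak L_k(\mathcal Y,\ell_Y)\big).$$ A stochastic realization of $\mathcal X$ on a probability space $(\Omega,\mathbb P)$ is a sequence of random variables $X_i:\Omega\to X$, $i\in\mathbb N=\{0,1,\dots\}$, with $\mathrm{law}(X_0)=\mu_X$ and $\mathbb P(X_{i+1}=x'\mid X_i=x)=m^X_x(x')$ for all $i,x,x'$. A Markovian coupling of $\mathcal X$ and $\mathcal Y$ is a sequence $\{(X_i,Y_i)\}_{i\in\mathbb N}$ in which $\{X_i\}$ and $\{Y_i\}$ are stochastic realizations of $\mathcal X$ and $\mathcal Y$ on one and the same probability space $(\Omega,\mathbb P)$ (any such space is allowed), such that 1. for all $i\ge 0$, $x_0,\dots,x_{i+1}\in X$ and $y_0,\dots,y_{i+1}\in Y$, the conditional probability $\mathbb P\big((X_{i+1},Y_{i+1})=(x_{i+1},y_{i+1})\mid (X_j,Y_j)=(x_j,y_j),\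 0\le j\le i\big)$ equals $\mathbb P\big((X_{i+1},Y_{i+1})=(x_{i+1},y_{i+1})\mid (X_i,Y_i)=(x_i,y_i)\big)$; 2. for all $i\ge0$, $x\in X$, $y\in Y$, the conditional law of $(X_{i+1},Y_{i+1})$ given $(X_i,Y_i)=(x,y)$ is a coupling of $m^X_x$ and $m^Y_y$. (Conditions involving conditional probabilities are imposed only when the conditioning event has positive probability.) Then for every $k\in\mathbb N$ the distance $d^{(k)}_{\mathrm{WL}}$ is finite and $$d^{(k)}_{\mathrm{WL}}\big((\mathcal X,\ell_X),(\mathcal Y,\ell_Y)\big)=\inf_{\{(X_i,Y_i)\}_{i\in\mathbb N}}\mathbb E\, d_Z\big(\ell_X(X_k),\ell_Y(Y_k)\big),$$ where the infimum is over the (nonempty) collection of all Markovian couplings of $\mathcal X$ and $\mathcal Y$. -/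

import Mathlib

open MeasureTheory ProbabilityTheory Set
open scoped ENNReal

universe u v w t

/-! ## Couplings -/

/-- `π` is a coupling of `α` and `β`: a probability measure on the product whose marginals are
`α` and `β`. -/
structure IsCoupling {A : Type u} {B : Type v} [MeasurableSpace A] [MeasurableSpace B]
    (π : Measure (A × B)) (α : Measure A) (β : Measure B) : Prop where
  isProbabilityMeasure : IsProbabilityMeasure π
  map_fst : π.map Prod.fst = α
  map_snd : π.map Prod.snd = β

/-! ## The spaces `𝒫(Z)`, `𝒫(𝒫(Z))`, … -/

/-- A set with a symmetric distance function vanishing on the diagonal. It only serves as a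
carrier for the iteration `Z, 𝒫(Z), 𝒫(𝒫(Z)), …`, which starts from a metric space `Z` and in
which every further distance is the Wasserstein distance of the preceding space; the remaining
metric axioms are not needed to write the definitions down. -/
structure DistSpace where
  carrier : Type u
  d : carrier → carrier → ℝ≥0∞
  d_self : ∀ x, d x x = 0
  d_comm : ∀ x y, d x y = d y x

namespace DistSpace

/-- The topology of the distance: `U` is open if it contains a ball around each of its points. -/
@[reducible] def topology (E : DistSpace.{u}) : TopologicalSpace E.carrier where
  IsOpen U := ∀ x ∈ U, ∃ ε : ℝ≥0∞, 0 < ε ∧ ∀ y, E.d x y < ε → y ∈ U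
  isOpen_univ := fun _ _ => ⟨1, one_pos, fun _ _ => mem_univ _⟩
  isOpen_inter := by
    rintro s t hs ht x ⟨hxs, hxt⟩
    obtain ⟨a, ha, ha'⟩ := hs x hxs
    obtain ⟨b, hb, hb'⟩ := ht x hxt
    exact ⟨min a b, lt_min ha hb, fun y hy =>
      ⟨ha' y (hy.trans_le (min_le_left _ _)), hb' y (hy.trans_le (min_le_right _ _))⟩⟩
  isOpen_sUnion := by
    rintro S hS x ⟨s, hs, hxs⟩
    obtain ⟨a, ha, ha'⟩ := hS s hs x hxs
    exact ⟨a, ha, fun y hy => ⟨s, hs, ha' y hy⟩⟩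

/-- The Borel σ-algebra of the distance. -/
instance instMeasurableSpaceCarrier (E : DistSpace.{u}) : MeasurableSpace E.carrier :=
  @borel E.carrier E.topology

/-- Finite first moment. -/
def HasFiniteMoment (E : DistSpace.{u}) (α : Measure E.carrier) : Prop :=
  ∀ z₀ : E.carrier, ∫⁻ z, E.d z z₀ ∂α < ⊤

/-- The (`ℓ₁`-)Wasserstein distance
`d_W(α, β) = inf { ∫ d(z, z') π(dz × dz') | π a coupling of α and β }`. -/
noncomputable def wasserstein (E : DistSpace.{u}) (α β : Measure E.carrier) : ℝ≥0∞ :=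
  ⨅ (π : Measure (E.carrier × E.carrier)) (_ : IsCoupling π α β), ∫⁻ p, E.d p.1 p.2 ∂π

theorem wasserstein_le (E : DistSpace.{u}) {α β : Measure E.carrier}
    {π : Measure (E.carrier × E.carrier)} (h : IsCoupling π α β) :
    E.wasserstein α β ≤ ∫⁻ p, E.d p.1 p.2 ∂π :=
  iInf₂_le (f := fun (π : Measure (E.carrier × E.carrier)) (_ : IsCoupling π α β) =>
    ∫⁻ p, E.d p.1 p.2 ∂π) π h

theorem wasserstein_self (E : DistSpace.{u}) (α : Measure E.carrier) [IsProbabilityMeasure α] :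
    E.wasserstein α α = 0 := by
  have hm : Measurable (fun z : E.carrier => (z, z)) := measurable_id.prodMk measurable_id
  have hc : IsCoupling (α.map (fun z => (z, z))) α α := by
    refine ⟨Measure.isProbabilityMeasure_map hm.aemeasurable, ?_, ?_⟩
    · rw [Measure.map_map measurable_fst hm]; exact Measure.map_id
    · rw [Measure.map_map measurable_snd hm]; exact Measure.map_id
  refine le_antisymm ((E.wasserstein_le hc).trans ((lintegral_map_le _ _).trans ?_)) zero_le
  simp [E.d_self]

theorem wasserstein_le_symm (E : DistSpace.{u}) (α β : Measure E.carrier) :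
    E.wasserstein α β ≤ E.wasserstein β α := by
  refine le_iInf₂ fun π hπ => ?_
  have hp := hπ.isProbabilityMeasure
  have hc : IsCoupling (π.map Prod.swap) α β := by
    refine ⟨Measure.isProbabilityMeasure_map measurable_swap.aemeasurable, ?_, ?_⟩
    · rw [Measure.map_map measurable_fst measurable_swap]; exact hπ.map_snd
    · rw [Measure.map_map measurable_snd measurable_swap]; exact hπ.map_fst
  refine (E.wasserstein_le hc).trans ((lintegral_map_le _ _).trans (le_of_eq ?_))
  simp [E.d_comm]

/-- A metric space as the start of the iteration. -/
def ofMetric (Z : Type u) [MetricSpace Z] : DistSpace.{u} where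
  carrier := Z
  d := edist
  d_self := edist_self
  d_comm := edist_comm

theorem topology_ofMetric (Z : Type u) [MetricSpace Z] :
    (ofMetric Z).topology = (inferInstance : TopologicalSpace Z) := by
  refine TopologicalSpace.ext_iff.2 fun (U : Set Z) => ?_
  refine Iff.trans ?_ (EMetric.isOpen_iff (s := U)).symm
  change (∀ x ∈ U, ∃ ε : ℝ≥0∞, 0 < ε ∧ ∀ y : Z, edist x y < ε → y ∈ U) ↔
    ∀ x ∈ U, ∃ ε > 0, ∀ y : Z, edist y x < ε → y ∈ U
  simp only [edist_comm, gt_iff_lt]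

/-- `𝒫(E)`: the Borel probability measures on `E` with finite first moment, with the Wasserstein
distance. -/
noncomputable def prob (E : DistSpace.{u}) : DistSpace.{u} where
  carrier := {α : Measure E.carrier // IsProbabilityMeasure α ∧ E.HasFiniteMoment α}
  d α β := E.wasserstein α.1 β.1
  d_self α := by
    have := α.2.1
    exact E.wasserstein_self α.1
  d_comm α β := le_antisymm (E.wasserstein_le_symm _ _) (E.wasserstein_le_symm _ _)

/-- `iterProb Z k` is `𝒫^{∘k}(Z)`, with `𝒫^{∘0}(Z) = Z`. -/
noncomputable def iterProb (Z : Type u) [MetricSpace Z] : ℕ → DistSpace.{u}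
  | 0 => ofMetric Z
  | k + 1 => (iterProb Z k).prob

/-! ### Push-forward of measures on finite sets -/

/-- All distances from `p` are finite. -/
def FiniteFrom (E : DistSpace.{u}) (p : E.carrier) : Prop := ∀ q, E.d p q < ⊤

section
variable {X : Type v} [Finite X] [MeasurableSpace X] [MeasurableSingletonClass X]

theorem lintegral_lt_top_of_finite (μ : Measure X) [IsProbabilityMeasure μ] (f : X → ℝ≥0∞)
    (hf : ∀ x, f x < ⊤) : ∫⁻ x, f x ∂μ < ⊤ := by
  have := Fintype.ofFinite X
  rw [lintegral_fintype]
  exact ENNReal.sum_lt_top.2 fun x _ => ENNReal.mul_lt_top (hf x) (measure_lt_top _ _)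

theorem hasFiniteMoment_map (E : DistSpace.{u}) (f : X → E.carrier)
    (hf : ∀ x, E.FiniteFrom (f x)) (μ : Measure X) [IsProbabilityMeasure μ] :
    E.HasFiniteMoment (μ.map f) := fun z₀ =>
  (lintegral_map_le _ _).trans_lt (lintegral_lt_top_of_finite μ _ fun x => hf x z₀)

/-- The push-forward `f_# μ ∈ 𝒫(E)` of a probability measure on a finite set. -/
noncomputable def push (E : DistSpace.{u}) (f : X → E.carrier)
    (hf : ∀ x, E.FiniteFrom (f x)) (μ : Measure X) [IsProbabilityMeasure μ] : E.prob.carrier :=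
  ⟨μ.map f, Measure.isProbabilityMeasure_map (measurable_of_finite f).aemeasurable,
    E.hasFiniteMoment_map f hf μ⟩

theorem finiteFrom_push (E : DistSpace.{u}) (f : X → E.carrier)
    (hf : ∀ x, E.FiniteFrom (f x)) (μ : Measure X) [IsProbabilityMeasure μ] :
    E.prob.FiniteFrom (E.push f hf μ) := by
  rintro ⟨β, hβ, hm⟩
  have := Fintype.ofFinite X
  have hfm : Measurable f := measurable_of_finite f
  have hg : Measurable (Prod.map f id : X × E.carrier → E.carrier × E.carrier) :=
    hfm.prodMap measurable_id
  have hc : IsCoupling ((μ.prod β).map (Prod.map f id)) (μ.map f) β := by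
    refine ⟨Measure.isProbabilityMeasure_map hg.aemeasurable, ?_, ?_⟩
    · rw [Measure.map_map measurable_fst hg]
      change (μ.prod β).map (f ∘ Prod.fst) = _
      rw [← Measure.map_map hfm measurable_fst, measurePreserving_fst.map_eq]
    · rw [Measure.map_map measurable_snd hg]
      exact measurePreserving_snd.map_eq
  refine lt_of_le_of_lt ((E.wasserstein_le hc).trans (lintegral_map_le _ _)) ?_
  have hs : μ.prod β = ∑ x : X, μ {x} • β.map (Prod.mk x) := by
    conv_lhs => rw [← Measure.sum_smul_dirac μ, Measure.sum_fintype]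
    ext s hs
    rw [Measure.prod_apply hs, Measure.finsetSum_apply]
    simp only [lintegral_finsetSum_measure, lintegral_smul_measure,
      Measure.smul_apply, lintegral_dirac]
    exact Finset.sum_congr rfl fun x _ => by rw [Measure.map_apply measurable_prodMk_left hs]
  rw [hs, lintegral_finsetSum_measure]
  refine ENNReal.sum_lt_top.2 fun x _ => ?_
  rw [lintegral_smul_measure]
  refine ENNReal.mul_lt_top (measure_lt_top _ _) ((lintegral_map_le _ _).trans_lt ?_)
  simpa [E.d_comm] using hm (f x)

end

end DistSpace

/-! ## Measure Markov chains and the Weisfeiler-Lehman distance -/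

/-- A measure Markov chain `(X, m, μ)`: a Markov kernel `m` and a stationary distribution `μ`. -/
structure MeasureMarkovChain (X : Type u) [MeasurableSpace X] where
  m : Kernel X X
  μ : Measure X
  isMarkovKernel : IsMarkovKernel m
  isProbabilityMeasure : IsProbabilityMeasure μ
  stationary : Kernel.Invariant m μ

attribute [instance] MeasureMarkovChain.isMarkovKernel MeasureMarkovChain.isProbabilityMeasure

namespace MeasureMarkovChain

section
variable {X : Type v} [Finite X] [MeasurableSpace X] [MeasurableSingletonClass X]
  {Z : Type u} [MetricSpace Z]

/-- The maps `𝔩^{(k)} : X → 𝒫^{∘k}(Z)`, `𝔩^{(0)} = ℓ` and `𝔩^{(k+1)} x = (𝔩^{(k)})_# m_x`, together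
with the fact that their values have finite distance to every point of `𝒫^{∘k}(Z)` (this gives the
finite first moments in the next step). -/
noncomputable def wlMap (M : MeasureMarkovChain X) (ℓ : X → Z) :
    (k : ℕ) → X → {p : (DistSpace.iterProb Z k).carrier // (DistSpace.iterProb Z k).FiniteFrom p}
  | 0 => fun x => ⟨ℓ x, fun q => edist_lt_top (α := Z) (ℓ x) q⟩
  | k + 1 => fun x =>
    ⟨(DistSpace.iterProb Z k).push (fun x' => (wlMap M ℓ k x').1) (fun x' => (wlMap M ℓ k x').2)
        (M.m x),
      (DistSpace.iterProb Z k).finiteFrom_push _ _ _⟩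

/-- `𝔏_k = (𝔩^{(k)})_# μ ∈ 𝒫^{∘(k+1)}(Z)`. -/
noncomputable def wlLaw (M : MeasureMarkovChain X) (ℓ : X → Z) (k : ℕ) :
    (DistSpace.iterProb Z (k + 1)).carrier :=
  (DistSpace.iterProb Z k).push (fun x => (M.wlMap ℓ k x).1) (fun x => (M.wlMap ℓ k x).2) M.μ

end

/-- The Weisfeiler-Lehman distance of depth `k`: the Wasserstein distance
`d_W(𝔏_k(M, ℓX), 𝔏_k(N, ℓY))`. -/
noncomputable def wlDist {X : Type v} {Y : Type w} {Z : Type u}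
    [Finite X] [MeasurableSpace X] [MeasurableSingletonClass X]
    [Finite Y] [MeasurableSpace Y] [MeasurableSingletonClass Y] [MetricSpace Z]
    (M : MeasureMarkovChain X) (ℓX : X → Z) (N : MeasureMarkovChain Y) (ℓY : Y → Z)
    (k : ℕ) : ℝ≥0∞ :=
  (DistSpace.iterProb Z (k + 1)).d (M.wlLaw ℓX k) (N.wlLaw ℓY k)

end MeasureMarkovChain

/-! ## Stochastic realizations and Markovian couplings -/

/-- A stochastic realization of `(X, m, μ)` on `(Ω, ℙ)`: random variables `ξ_i` with
`law(ξ_0) = μ` and `ℙ(ξ_{i+1} = x' | ξ_i = x) = m_x(x')` (whenever the conditional probability is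
defined). -/
structure IsStochasticRealization {X : Type u} [MeasurableSpace X] (M : MeasureMarkovChain X)
    {Ω : Type w} [MeasurableSpace Ω] (P : Measure Ω) (ξ : ℕ → Ω → X) : Prop where
  measurable : ∀ i, Measurable (ξ i)
  law_zero : P.map (ξ 0) = M.μ
  transition : ∀ (i : ℕ) (x x' : X), P {ω | ξ i ω = x} ≠ 0 →
    cond P {ω | ξ i ω = x} {ω | ξ (i + 1) ω = x'} = M.m x {x'}

/-- Two stochastic realizations on the same probability space form a Markovian coupling. -/
structure IsMarkovianCoupling {X : Type u} {Y : Type v} [MeasurableSpace X] [MeasurableSpace Y]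
    (M : MeasureMarkovChain X) (N : MeasureMarkovChain Y)
    {Ω : Type w} [MeasurableSpace Ω] (P : Measure Ω)
    (ξ : ℕ → Ω → X) (η : ℕ → Ω → Y) : Prop where
  left : IsStochasticRealization M P ξ
  right : IsStochasticRealization N P η
  /-- The Markov property of the pair process. -/
  markov : ∀ (i : ℕ) (x : ℕ → X) (y : ℕ → Y),
    P {ω | ∀ j ≤ i, (ξ j ω, η j ω) = (x j, y j)} ≠ 0 →
    cond P {ω | ∀ j ≤ i, (ξ j ω, η j ω) = (x j, y j)}
        {ω | (ξ (i + 1) ω, η (i + 1) ω) = (x (i + 1), y (i + 1))} =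
      cond P {ω | (ξ i ω, η i ω) = (x i, y i)}
        {ω | (ξ (i + 1) ω, η (i + 1) ω) = (x (i + 1), y (i + 1))}
  /-- The conditional law of the next pair is a coupling of the two transition laws. -/
  transition : ∀ (i : ℕ) (x : X) (y : Y), P {ω | (ξ i ω, η i ω) = (x, y)} ≠ 0 →
    IsCoupling ((cond P {ω | (ξ i ω, η i ω) = (x, y)}).map
      (fun ω => (ξ (i + 1) ω, η (i + 1) ω))) (M.m x) (N.m y)

/-! Let c_j(x, y) be the distance between the depth-j labels of x and y (`wlCost`). Depth-(j+1)
labels are push-forwards of the transition laws, so c_{j+1}(x, y) is the infimum of ∫ c_j dγ over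
couplings γ of m_x and m_y. Likewise the distance of depth k is the infimum of ∫ c_k dγ over
couplings of the stationary laws. This is a dynamic programming recursion that ends in c_0 = d_Z(ℓX,
ℓY).

Along any Markovian coupling, E c_{k-i}(X_i, Y_i) is at least the distance for i = 0 and
nondecreasing for i ≤ k (`lintegral_wlCost_succ_le`); i = k gives the lower bound. Conversely, a
Markov chain driven by ε-optimal one-step couplings loses at most ε at the start and at each step,
which gives the upper bound (`exists_isMarkovianCoupling_lintegral_le`).

The delicate point is to replace couplings on 𝒫^{∘k}(Z) by couplings on X × Y
(`exists_isCoupling_of_map`). This reads off masses of atoms, so singletons of labels must be Borel.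
Instead of proving the metric axioms for iterated Wasserstein distances, each label is shown to be
the unique zero of a bounded Lipschitz function. This property passes from finitely many points to
the measures carried by them, because integration against such a function is Lipschitz for the
Wasserstein distance. -/

/-! ### Bounded Lipschitz functions and measurability of label singletons -/

namespace DistSpace

/-- Bounded real functions that are Lipschitz for the distance of `E`. -/
def BoundedLipschitz (E : DistSpace.{u}) (φ : E.carrier → ℝ) : Prop :=
  ∃ C : NNReal, (∀ z, ‖φ z‖ₑ ≤ C) ∧ ∀ z w, ‖φ z - φ w‖ₑ ≤ C * E.d z w

namespace BoundedLipschitz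

variable {E : DistSpace.{u}} {φ ψ : E.carrier → ℝ}

theorem const (c : ℝ) : E.BoundedLipschitz (fun _ => c) :=
  ⟨‖c‖₊, fun _ => le_rfl, fun z w => by simp⟩

theorem add (hφ : E.BoundedLipschitz φ) (hψ : E.BoundedLipschitz ψ) :
    E.BoundedLipschitz (fun z => φ z + ψ z) := by
  obtain ⟨C, hC, hC'⟩ := hφ
  obtain ⟨D, hD, hD'⟩ := hψ
  refine ⟨C + D, fun z => ?_, fun z w => ?_⟩
  · push_cast
    exact (enorm_add_le _ _).trans (add_le_add (hC z) (hD z))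
  · push_cast
    rw [add_sub_add_comm, add_mul]
    exact (enorm_add_le _ _).trans (add_le_add (hC' z w) (hD' z w))

theorem mul (hφ : E.BoundedLipschitz φ) (hψ : E.BoundedLipschitz ψ) :
    E.BoundedLipschitz (fun z => φ z * ψ z) := by
  obtain ⟨C, hC, hC'⟩ := hφ
  obtain ⟨D, hD, hD'⟩ := hψ
  refine ⟨C * D + C * D, fun z => ?_, fun z w => ?_⟩
  · push_cast
    rw [enorm_mul]
    exact (mul_le_mul' (hC z) (hD z)).trans le_self_add
  · push_cast
    have h : φ z * ψ z - φ w * ψ w = φ z * (ψ z - ψ w) + (φ z - φ w) * ψ w := by ring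
    rw [h, add_mul]
    refine (enorm_add_le _ _).trans (add_le_add ?_ ?_)
    · rw [enorm_mul, mul_assoc]
      exact mul_le_mul' (hC z) (hD' z w)
    · rw [enorm_mul, mul_right_comm]
      exact mul_le_mul' (hC' z w) (hD w)

theorem abs_sub (hφ : E.BoundedLipschitz φ) (c : ℝ) :
    E.BoundedLipschitz (fun z => |φ z - c|) := by
  obtain ⟨C, hC, hC'⟩ := hφ
  refine ⟨C + ‖c‖₊, fun z => ?_, fun z w => ?_⟩
  · push_cast
    rw [← Real.norm_eq_abs, enorm_norm]
    exact (enorm_sub_le).trans (add_le_add (hC z) le_rfl)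
  · push_cast
    have h : ‖|φ z - c| - |φ w - c|‖ₑ ≤ ‖φ z - φ w‖ₑ := by
      rw [enorm_le_iff_norm_le, Real.norm_eq_abs, Real.norm_eq_abs]
      simpa using abs_abs_sub_abs_le_abs_sub (φ z - c) (φ w - c)
    exact h.trans ((hC' z w).trans (mul_le_mul' le_self_add le_rfl))

theorem sum {ι : Type*} (s : Finset ι) {f : ι → E.carrier → ℝ}
    (hf : ∀ i ∈ s, E.BoundedLipschitz (f i)) :
    E.BoundedLipschitz (fun z => ∑ i ∈ s, f i z) := by
  classical
  induction s using Finset.induction_on with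
  | empty => simpa using const 0
  | insert i s hi ih =>
    simp only [Finset.sum_insert hi]
    exact (hf i (by simp)).add (ih fun j hj => hf j (by simp [hj]))

theorem prod {ι : Type*} (s : Finset ι) {f : ι → E.carrier → ℝ}
    (hf : ∀ i ∈ s, E.BoundedLipschitz (f i)) :
    E.BoundedLipschitz (fun z => ∏ i ∈ s, f i z) := by
  classical
  induction s using Finset.induction_on with
  | empty => simpa using const 1
  | insert i s hi ih =>
    simp only [Finset.prod_insert hi]
    exact (hf i (by simp)).mul (ih fun j hj => hf j (by simp [hj]))

theorem measurable (hφ : E.BoundedLipschitz φ) : Measurable φ := by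
  obtain ⟨C, -, hC⟩ := hφ
  let _ := E.topology
  have : BorelSpace E.carrier := ⟨rfl⟩
  refine Continuous.measurable (continuous_def.2 fun U hU x hx => ?_)
  obtain ⟨ε, hε, hU⟩ := EMetric.isOpen_iff.1 hU _ hx
  refine ⟨ε / (C + 1), ENNReal.div_pos hε.ne' (by finiteness), fun y hy => hU ?_⟩
  rw [Metric.mem_eball, edist_comm, edist_eq_enorm_sub]
  refine (hC x y).trans_lt (lt_of_le_of_lt (mul_le_mul' le_self_add le_rfl)
    (ENNReal.mul_lt_of_lt_div' hy))

theorem integrable (hφ : E.BoundedLipschitz φ) (α : Measure E.carrier) [IsFiniteMeasure α] :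
    Integrable φ α := by
  have hm := hφ.measurable
  obtain ⟨C, hC, -⟩ := hφ
  refine Integrable.of_bound hm.aestronglyMeasurable C (Filter.Eventually.of_forall fun z => ?_)
  have := hC z
  rwa [← enorm_norm, Real.enorm_eq_ofReal (norm_nonneg _), ENNReal.ofReal_le_iff_le_toReal (by simp)]
    at this

/-- Integration of a bounded Lipschitz function is bounded Lipschitz for the Wasserstein
distance. -/
theorem integral (hφ : E.BoundedLipschitz φ) :
    E.prob.BoundedLipschitz (fun α => ∫ z, φ z ∂α.1) := by
  have hm := hφ.measurable
  have hint := hφ.integrable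
  obtain ⟨C, hC, hC'⟩ := hφ
  -- `C + 1` instead of `C`: a nonzero constant can be moved inside the infimum over couplings.
  refine ⟨C + 1, fun α => ?_, fun α β => ?_⟩
  · have := α.2.1
    refine (enorm_integral_le_lintegral_enorm _).trans ((lintegral_mono hC).trans ?_)
    simp
  · have hα := α.2.1
    have hβ := β.2.1
    change _ ≤ _ * E.wasserstein α.1 β.1
    unfold wasserstein
    rw [ENNReal.mul_iInf_of_ne (by simp) (by simp)]
    refine le_iInf fun π => ?_
    rw [ENNReal.mul_iInf_of_ne (by simp) (by simp)]
    refine le_iInf fun hπ => ?_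
    have hp := hπ.isProbabilityMeasure
    have h1 : ∫ z, φ z ∂α.1 = ∫ p, φ p.1 ∂π := by
      rw [← hπ.map_fst, integral_map measurable_fst.aemeasurable hm.aestronglyMeasurable]
    have h2 : ∫ z, φ z ∂β.1 = ∫ p, φ p.2 ∂π := by
      rw [← hπ.map_snd, integral_map measurable_snd.aemeasurable hm.aestronglyMeasurable]
    have i1 : Integrable (fun p : E.carrier × E.carrier => φ p.1) π :=
      Integrable.comp_measurable (by rw [hπ.map_fst]; exact hint _) measurable_fst
    have i2 : Integrable (fun p : E.carrier × E.carrier => φ p.2) π :=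
      Integrable.comp_measurable (by rw [hπ.map_snd]; exact hint _) measurable_snd
    change ‖∫ z, φ z ∂(α.1 : Measure E.carrier) - ∫ z, φ z ∂(β.1 : Measure E.carrier)‖ₑ ≤ _
    rw [h1, h2, ← integral_sub i1 i2, ← lintegral_const_mul' _ _ (by simp)]
    refine (enorm_integral_le_lintegral_enorm _).trans (lintegral_mono fun p => ?_)
    exact (hC' _ _).trans (mul_le_mul' (by simp) le_rfl)

end BoundedLipschitz

/-- `a` is the unique zero of some nonnegative bounded Lipschitz function. -/
def IsLipschitzSeparated (E : DistSpace.{u}) (a : E.carrier) : Prop :=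
  ∃ φ, E.BoundedLipschitz φ ∧ (∀ z, 0 ≤ φ z) ∧ ∀ z, φ z = 0 ↔ z = a

theorem IsLipschitzSeparated.measurableSet_singleton {E : DistSpace.{u}} {a : E.carrier}
    (h : E.IsLipschitzSeparated a) : MeasurableSet {a} := by
  obtain ⟨φ, hφ, -, h⟩ := h
  have : ({a} : Set E.carrier) = φ ⁻¹' {0} := by ext z; simp [h]
  rw [this]
  exact hφ.measurable (MeasurableSet.singleton _)

theorem isLipschitzSeparated_ofMetric {Z : Type u} [MetricSpace Z] (a : Z) :
    (ofMetric Z).IsLipschitzSeparated a := by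
  refine ⟨fun z : Z => min 1 (dist z a), ⟨1, fun (z : Z) => ?_, fun (z w : Z) => ?_⟩,
    fun (z : Z) => by positivity, fun (z : Z) => ?_⟩
  · rw [Real.enorm_eq_ofReal (by positivity)]
    simp
  · change _ ≤ _ * edist z w
    rw [ENNReal.coe_one, one_mul, edist_dist, Real.enorm_eq_ofReal_abs]
    refine ENNReal.ofReal_le_ofReal ((abs_min_sub_min_le_max _ _ _ _).trans ?_)
    simpa using abs_dist_sub_le z w a
  · constructor
    · intro h
      change min 1 (dist z a) = 0 at h
      rcases min_choice (1 : ℝ) (dist z a) with h' | h' <;> rw [h'] at h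
      · norm_num at h
      · exact (dist_eq_zero (γ := Z)).1 h
    · intro h
      have h : z = a := h
      simp [h]

section
variable {X : Type v} [Finite X] [MeasurableSpace X] [MeasurableSingletonClass X]

/-- The product `S` of all `φ x` vanishes exactly on `range f`, so `∫ S = 0` says that a measure is
carried by `range f`. On that set `Q x` vanishes except at `f x`, so `∫ Q x` then determines the
mass of `f x`. The separating function adds `∫ S` to the deviations of the `∫ Q x` from their values
at the push-forward; at a zero, the support and all atoms agree. -/
theorem IsLipschitzSeparated.push {E : DistSpace.{u}} (f : X → E.carrier)
    (hf : ∀ x, E.FiniteFrom (f x)) (hs : ∀ x, E.IsLipschitzSeparated (f x))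
    (μ : Measure X) [IsProbabilityMeasure μ] :
    E.prob.IsLipschitzSeparated (E.push f hf μ) := by
  classical
  have := Fintype.ofFinite X
  have hsing := fun x => (hs x).measurableSet_singleton
  choose φ hφ hφ0 hφs using hs
  let S : E.carrier → ℝ := fun z => ∏ x, φ x z
  let Q : X → E.carrier → ℝ := fun x z => ∏ y with f y ≠ f x, φ y z
  have hS : E.BoundedLipschitz S := BoundedLipschitz.prod _ fun x _ => hφ x
  have hQ : ∀ x, E.BoundedLipschitz (Q x) := fun x => BoundedLipschitz.prod _ fun y _ => hφ y
  have hS0 : ∀ z, 0 ≤ S z := fun z => Finset.prod_nonneg fun x _ => hφ0 x z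
  have hSz : ∀ z, S z = 0 ↔ z ∈ range f := fun z => by
    simp only [S, Finset.prod_eq_zero_iff, hφs, Finset.mem_univ, true_and, mem_range,
      eq_comm (a := z)]
  have hQself : ∀ x, Q x (f x) ≠ 0 := fun x => by
    simp only [Q, Finset.prod_ne_zero_iff, Finset.mem_filter, Finset.mem_univ, true_and, ne_eq, hφs]
    exact fun y hy h => hy h.symm
  have hQne : ∀ x z, z ∈ range f → z ≠ f x → Q x z = 0 := by
    rintro x _ ⟨y, rfl⟩ hy
    exact Finset.prod_eq_zero (i := y) (by simpa using hy) ((hφs _ _).2 rfl)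
  set p : E.prob.carrier := E.push f hf μ with hp
  have hfm : Measurable f := measurable_of_finite f
  have hpS : ∫ z, S z ∂p.1 = 0 := by
    change ∫ z, S z ∂(μ.map f) = 0
    rw [integral_map hfm.aemeasurable hS.measurable.aestronglyMeasurable]
    simp [(hSz _).2 (mem_range_self _)]
  -- if `∫ S = 0` then `∫ Q x` computes the mass of `f x`
  have key : ∀ q : E.prob.carrier, ∫ z, S z ∂q.1 = 0 →
      q.1 (range f)ᶜ = 0 ∧ ∀ x, ∫ z, Q x z ∂q.1 = Q x (f x) * q.1.real {f x} := by
    intro q hq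
    have := q.2.1
    have h0 : ∀ᵐ z ∂q.1, z ∈ range f := by
      filter_upwards [(integral_eq_zero_iff_of_nonneg hS0 (hS.integrable q.1)).1 hq] with z hz
      exact (hSz z).1 hz
    refine ⟨h0, fun x => ?_⟩
    have : ∫ z, Q x z ∂q.1 = ∫ z, ({f x} : Set E.carrier).indicator (fun _ => Q x (f x)) z ∂q.1 := by
      refine integral_congr_ae ?_
      filter_upwards [h0] with z hz
      by_cases h : z = f x
      · simp [h]
      · simp [h, hQne x z hz h]
    rw [this, integral_indicator_const _ (hsing x), smul_eq_mul, mul_comm]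
  refine ⟨fun q => ∫ z, S z ∂q.1 + ∑ x, |∫ z, Q x z ∂q.1 - ∫ z, Q x z ∂p.1|,
    hS.integral.add (BoundedLipschitz.sum _ fun x _ => (hQ x).integral.abs_sub _),
    fun q => add_nonneg (integral_nonneg hS0) (Finset.sum_nonneg fun x _ => abs_nonneg _),
    fun q => ⟨fun h => ?_, fun h => by simp [h, hpS]⟩⟩
  obtain ⟨h1, h2⟩ := (add_eq_zero_iff_of_nonneg (integral_nonneg hS0)
    (Finset.sum_nonneg fun x _ => abs_nonneg _)).1 h
  have h2' : ∀ x, ∫ z, Q x z ∂q.1 = ∫ z, Q x z ∂p.1 := fun x => by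
    have := (Finset.sum_eq_zero_iff_of_nonneg fun x _ => abs_nonneg _).1 h2 x (Finset.mem_univ x)
    linarith [abs_eq_zero.1 this]
  obtain ⟨kq, kq'⟩ := key q h1
  obtain ⟨kp, kp'⟩ := key p hpS
  have hqp := q.2.1
  have hpp := p.2.1
  have hmass : ∀ x, q.1 {f x} = p.1 {f x} := fun x => by
    have := h2' x
    rw [kq', kp'] at this
    exact (measureReal_eq_measureReal_iff).1 (mul_left_cancel₀ (hQself x) this)
  have hdec : ∀ r : Measure E.carrier, r (range f)ᶜ = 0 → ∀ s, MeasurableSet s →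
      r s = ∑ a ∈ Finset.univ.image f with a ∈ s, r {a} := by
    intro r hr s _
    rw [← measure_inter_conull hr]
    have he : s ∩ range f = ⋃ a ∈ (Finset.univ.image f).filter (· ∈ s), {a} := by
      ext z; simp [and_comm]
    rw [he, measure_biUnion_finset]
    · intro a _ b _ hab
      simpa [Function.onFun] using hab
    · intro a ha
      obtain ⟨x, -, rfl⟩ := Finset.mem_image.1 (Finset.mem_filter.1 ha).1
      exact hsing x
  refine Subtype.ext (Measure.ext fun s hs => ?_)
  rw [hdec _ kq s hs, hdec _ kp s hs]
  refine Finset.sum_congr rfl fun a ha => ?_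
  obtain ⟨x, -, rfl⟩ := Finset.mem_image.1 (Finset.mem_filter.1 ha).1
  exact hmass x

end
end DistSpace

namespace MeasureMarkovChain
variable {X : Type v} [Finite X] [MeasurableSpace X] [MeasurableSingletonClass X]
  {Z : Type u} [MetricSpace Z]

theorem isLipschitzSeparated_wlMap (M : MeasureMarkovChain X) (ℓ : X → Z) (k : ℕ) (x : X) :
    (DistSpace.iterProb Z k).IsLipschitzSeparated (M.wlMap ℓ k x).1 := by
  induction k generalizing x with
  | zero => exact DistSpace.isLipschitzSeparated_ofMetric (ℓ x)
  | succ k ih => exact DistSpace.IsLipschitzSeparated.push _ (fun x' => (M.wlMap ℓ k x').2) ih _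

end MeasureMarkovChain

/-! ### Lifting couplings of push-forwards to the finite sets -/

/-- A measure carried by the range of `f` is the sum of its atoms. -/
theorem measure_eq_sum_image {X : Type v} {E : Type u} [MeasurableSpace E]
    [Fintype X] [DecidableEq E] (ρ : Measure E) (f : X → E)
    (hf : ∀ x, MeasurableSet {f x}) (hρ : ρ (range f)ᶜ = 0) :
    ρ univ = ∑ a ∈ Finset.univ.image f, ρ {a} := by
  rw [← measure_biUnion_finset]
  · rw [← measure_inter_conull (s := univ) hρ]
    congr 1
    ext z; simp [eq_comm]
  · intro a _ b _ hab
    simpa [Function.onFun] using hab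
  · intro a ha
    obtain ⟨x, -, rfl⟩ := Finset.mem_image.1 ha
    exact hf x

section
variable {X : Type v} {Y : Type w} {E : Type u} [MeasurableSpace X] [MeasurableSpace Y]
  [MeasurableSpace E]

/-- The conditional weight of `x` in its fiber under `f`. -/
noncomputable def fiberWeight (μ : Measure X) (f : X → E) (x : X) : ℝ≥0∞ :=
  μ {x} / μ.map f {f x}

theorem map_singleton_eq_sum [Fintype X] [MeasurableSingletonClass X] [DecidableEq E]
    (μ : Measure X) (f : X → E) {a : E} (ha : MeasurableSet {a}) :
    μ.map f {a} = ∑ x with f x = a, μ {x} := by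
  rw [Measure.map_apply (measurable_of_finite f) ha, sum_measure_singleton]
  congr 1
  ext x
  simp

/-- The weights sum to 1 over every fiber of positive mass. Over a null fiber they do not, and there
`h0` makes the summand vanish. -/
theorem sum_fiberWeight_mul [Fintype X] [MeasurableSingletonClass X] [DecidableEq E]
    (μ : Measure X) [IsProbabilityMeasure μ] (f : X → E) (hf : ∀ x, MeasurableSet {f x})
    (h : E → ℝ≥0∞) (h0 : ∀ x, μ.map f {f x} = 0 → h (f x) = 0) :
    ∑ x, fiberWeight μ f x * h (f x) = ∑ a ∈ Finset.univ.image f, h a := by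
  have hp := Measure.isProbabilityMeasure_map (μ := μ) (measurable_of_finite f).aemeasurable
  rw [← Finset.sum_fiberwise_of_maps_to (g := f) (t := Finset.univ.image f)
    fun x _ => Finset.mem_image_of_mem f (Finset.mem_univ x)]
  refine Finset.sum_congr rfl fun a ha => ?_
  obtain ⟨x, -, rfl⟩ := Finset.mem_image.1 ha
  have h1 : ∑ y with f y = f x, fiberWeight μ f y * h (f y) =
      (∑ y with f y = f x, μ {y}) / μ.map f {f x} * h (f x) := by
    rw [div_eq_mul_inv, Finset.sum_mul, Finset.sum_mul]
    refine Finset.sum_congr rfl fun y hy => ?_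
    rw [fiberWeight, (Finset.mem_filter.1 hy).2, div_eq_mul_inv]
  rw [h1, ← map_singleton_eq_sum μ f (hf x)]
  by_cases hz : μ.map f {f x} = 0
  · rw [h0 x hz, mul_zero]
  · rw [ENNReal.div_self hz (measure_ne_top _ _), one_mul]

theorem fiberWeight_mul_map [Finite X] [MeasurableSingletonClass X]
    (μ : Measure X) [IsProbabilityMeasure μ] (f : X → E) (hf : ∀ x, MeasurableSet {f x}) (x : X) :
    fiberWeight μ f x * μ.map f {f x} = μ {x} := by
  have hp := Measure.isProbabilityMeasure_map (μ := μ) (measurable_of_finite f).aemeasurable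
  refine ENNReal.div_mul_cancel' (fun h => ?_) fun h => absurd h (measure_ne_top _ _)
  rw [Measure.map_apply (measurable_of_finite f) (hf x)] at h
  exact measure_mono_null (by simp) h

theorem map_compl_range [Finite X] [MeasurableSingletonClass X]
    (μ : Measure X) (f : X → E) (hf : ∀ x, MeasurableSet {f x}) :
    μ.map f (range f)ᶜ = 0 := by
  have : MeasurableSet (range f) := by
    rw [← iUnion_singleton_eq_range]
    exact MeasurableSet.iUnion hf
  rw [Measure.map_apply (measurable_of_finite f) this.compl]
  simp

/-- A finite sum of atoms is a coupling when its row and column sums are the given marginals. -/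
theorem isCoupling_sum_dirac [Fintype X] [Fintype Y] [MeasurableSingletonClass X]
    [MeasurableSingletonClass Y] {μ : Measure X} [IsProbabilityMeasure μ] {ν : Measure Y}
    (c : X → Y → ℝ≥0∞) (hμ : ∀ x, ∑ y, c x y = μ {x}) (hν : ∀ y, ∑ x, c x y = ν {y}) :
    IsCoupling (∑ p : X × Y, c p.1 p.2 • Measure.dirac p) μ ν := by
  classical
  have h1 : (∑ p : X × Y, c p.1 p.2 • Measure.dirac p).map Prod.fst = μ := by
    refine Measure.ext_of_singleton fun x => ?_
    rw [Measure.map_apply measurable_fst (MeasurableSet.singleton x), Measure.finsetSum_apply,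
      Fintype.sum_prod_type, ← hμ, Finset.sum_eq_single x]
    · simp
    · intro y _ hy
      simp [hy]
    · simp
  have h2 : (∑ p : X × Y, c p.1 p.2 • Measure.dirac p).map Prod.snd = ν := by
    refine Measure.ext_of_singleton fun y => ?_
    rw [Measure.map_apply measurable_snd (MeasurableSet.singleton y), Measure.finsetSum_apply,
      Fintype.sum_prod_type_right, ← hν, Finset.sum_eq_single y]
    · simp
    · intro x _ hx
      simp [hx]
    · simp
  refine ⟨⟨?_⟩, h1, h2⟩
  rw [← measure_univ (μ := μ), ← h1, Measure.map_apply measurable_fst MeasurableSet.univ,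
    preimage_univ]

variable [Finite X] [MeasurableSingletonClass X] [Finite Y] [MeasurableSingletonClass Y]

/-- Couplings of push-forwards from finite sets lift to the finite sets, without increasing the
(possibly non-measurable) cost. -/
theorem exists_isCoupling_of_map {F : Type u} [MeasurableSpace F]
    {μ : Measure X} [IsProbabilityMeasure μ] {ν : Measure Y} [IsProbabilityMeasure ν]
    {f : X → E} {g : Y → F} (hf : ∀ x, MeasurableSet {f x}) (hg : ∀ y, MeasurableSet {g y})
    {π : Measure (E × F)} (hπ : IsCoupling π (μ.map f) (ν.map g)) (d : E → F → ℝ≥0∞) :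
    ∃ γ : Measure (X × Y), IsCoupling γ μ ν ∧
      ∫⁻ p, d (f p.1) (g p.2) ∂γ ≤ ∫⁻ q, d q.1 q.2 ∂π := by
  classical
  have := Fintype.ofFinite X
  have := Fintype.ofFinite Y
  have hp := hπ.isProbabilityMeasure
  have hmarg1 : ∀ x, μ.map f {f x} = π ({f x} ×ˢ univ) := fun x => by
    rw [← hπ.map_fst, Measure.map_apply measurable_fst (hf x), prod_univ]
  have hmarg2 : ∀ y, ν.map g {g y} = π (univ ×ˢ {g y}) := fun y => by
    rw [← hπ.map_snd, Measure.map_apply measurable_snd (hg y), univ_prod]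
  have hz1 : ∀ x b, μ.map f {f x} = 0 → π {(f x, b)} = 0 := fun x b h =>
    measure_mono_null (by simp) ((hmarg1 x).symm.trans h)
  have hz2 : ∀ y a, ν.map g {g y} = 0 → π {(a, g y)} = 0 := fun y a h =>
    measure_mono_null (by simp) ((hmarg2 y).symm.trans h)
  have hs : ∀ x y, MeasurableSet {(f x, g y)} := fun x y => by
    rw [← singleton_prod_singleton]; exact (hf x).prod (hg y)
  have hrf : MeasurableSet (range f) := by
    rw [← iUnion_singleton_eq_range]; exact MeasurableSet.iUnion hf
  have hrg : MeasurableSet (range g) := by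
    rw [← iUnion_singleton_eq_range]; exact MeasurableSet.iUnion hg
  -- The second marginal of `π` is carried by `range g`, so the mass of the strip over `f x` is the
  -- sum of its atoms.
  have hrow : ∀ x, ∑ b ∈ Finset.univ.image g, π {(f x, b)} = μ.map f {f x} := fun x => by
    have hsnd : ∀ s : Set F, MeasurableSet s →
        (π.restrict ({f x} ×ˢ univ)).map Prod.snd s = π ({f x} ×ˢ s) := fun s h => by
      rw [Measure.map_apply measurable_snd h, Measure.restrict_apply (measurable_snd h)]
      congr 1
      ext p; simp [and_comm]
    have h := measure_eq_sum_image ((π.restrict ({f x} ×ˢ univ)).map Prod.snd) g hg ?_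
    · rw [hsnd _ MeasurableSet.univ] at h
      rw [hmarg1, h]
      refine Finset.sum_congr rfl fun b hb => ?_
      obtain ⟨y, -, rfl⟩ := Finset.mem_image.1 hb
      rw [hsnd _ (hg y), singleton_prod_singleton]
    · rw [hsnd _ hrg.compl]
      have := map_compl_range ν g hg
      rw [← hπ.map_snd, Measure.map_apply measurable_snd hrg.compl] at this
      exact measure_mono_null (fun p hp => hp.2) this
  have hcol : ∀ y, ∑ a ∈ Finset.univ.image f, π {(a, g y)} = ν.map g {g y} := fun y => by
    have hfst : ∀ s : Set E, MeasurableSet s →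
        (π.restrict (univ ×ˢ {g y})).map Prod.fst s = π (s ×ˢ {g y}) := fun s h => by
      rw [Measure.map_apply measurable_fst h, Measure.restrict_apply (measurable_fst h)]
      congr 1
      ext p; simp
    have h := measure_eq_sum_image ((π.restrict (univ ×ˢ {g y})).map Prod.fst) f hf ?_
    · rw [hfst _ MeasurableSet.univ] at h
      rw [hmarg2, h]
      refine Finset.sum_congr rfl fun a ha => ?_
      obtain ⟨x, -, rfl⟩ := Finset.mem_image.1 ha
      rw [hfst _ (hf x), singleton_prod_singleton]
    · rw [hfst _ hrf.compl]
      have := map_compl_range μ f hf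
      rw [← hπ.map_fst, Measure.map_apply measurable_fst hrf.compl] at this
      exact measure_mono_null (fun p hp => hp.1) this
  -- Each atom of `π` is spread over its fiber in X × Y, independently in the two factors, by the
  -- conditional weights of `μ` and `ν`.
  let c : X → Y → ℝ≥0∞ := fun x y => fiberWeight μ f x * (fiberWeight ν g y * π {(f x, g y)})
  refine ⟨_, isCoupling_sum_dirac c (fun x => ?_) (fun y => ?_), ?_⟩
  · rw [← Finset.mul_sum, sum_fiberWeight_mul ν g hg (fun b => π {(f x, b)})
      fun y h => hz2 y _ h, hrow, fiberWeight_mul_map μ f hf]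
  · simp only [c, mul_left_comm (fiberWeight μ f _)]
    rw [← Finset.mul_sum, sum_fiberWeight_mul μ f hf (fun a => π {(a, g y)})
      fun x h => hz1 x _ h, hcol, fiberWeight_mul_map ν g hg]
  · have hcost : ∑ p : X × Y, c p.1 p.2 * d (f p.1) (g p.2) =
        ∑ a ∈ Finset.univ.image f, ∑ b ∈ Finset.univ.image g, π {(a, b)} * d a b := by
      rw [Fintype.sum_prod_type]
      have : ∀ x, ∑ y, c x y * d (f x) (g y) =
          fiberWeight μ f x * ∑ b ∈ Finset.univ.image g, π {(f x, b)} * d (f x) b := fun x => by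
        rw [← sum_fiberWeight_mul ν g hg (fun b => π {(f x, b)} * d (f x) b)
          fun y h => by rw [hz2 y _ h, zero_mul], Finset.mul_sum]
        exact Finset.sum_congr rfl fun y _ => by ring
      simp only [this]
      refine sum_fiberWeight_mul μ f hf
        (fun a => ∑ b ∈ Finset.univ.image g, π {(a, b)} * d a b) fun x h => ?_
      exact Finset.sum_eq_zero fun b _ => by rw [hz1 x b h, zero_mul]
    rw [lintegral_finsetSum_measure]
    simp only [lintegral_smul_measure, lintegral_dirac, smul_eq_mul]
    rw [hcost, ← Finset.sum_product']
    have hmeas : ∀ q ∈ Finset.univ.image f ×ˢ Finset.univ.image g, MeasurableSet {q} := by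
      rintro ⟨a, b⟩ hq
      obtain ⟨ha, hb⟩ := Finset.mem_product.1 hq
      obtain ⟨x, -, rfl⟩ := Finset.mem_image.1 ha
      obtain ⟨y, -, rfl⟩ := Finset.mem_image.1 hb
      exact hs x y
    -- The function supported on the finitely many atoms is measurable and lies below `d`, so
    -- monotonicity of the lower integral suffices even if `d` is not measurable.
    calc _ = ∫⁻ p, ∑ q ∈ Finset.univ.image f ×ˢ Finset.univ.image g,
          ({q} : Set (E × F)).indicator (fun _ => d q.1 q.2) p ∂π := by
          rw [lintegral_finsetSum _ fun q hq => measurable_const.indicator (hmeas q hq)]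
          refine Finset.sum_congr rfl fun q hq => ?_
          rw [lintegral_indicator_const (hmeas q hq), mul_comm]
      _ ≤ _ := by
          refine lintegral_mono fun p => ?_
          simp only [indicator_apply, mem_singleton_iff, Finset.sum_ite_eq]
          split_ifs <;> simp

end

namespace DistSpace
variable {X : Type v} {Y : Type w} [Finite X] [MeasurableSpace X] [MeasurableSingletonClass X]
  [Finite Y] [MeasurableSpace Y] [MeasurableSingletonClass Y] (E : DistSpace.{u})
  {μ : Measure X} {ν : Measure Y} {f : X → E.carrier} {g : Y → E.carrier}

/-- Push `γ` forward along `f × g`. `lintegral_map_le` asks no measurability of the cost and goes in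
the direction needed. -/
theorem wasserstein_map_le {γ : Measure (X × Y)} (hγ : IsCoupling γ μ ν) :
    E.wasserstein (μ.map f) (ν.map g) ≤ ∫⁻ p, E.d (f p.1) (g p.2) ∂γ := by
  have hp := hγ.isProbabilityMeasure
  have hfm : Measurable f := measurable_of_finite f
  have hgm : Measurable g := measurable_of_finite g
  have hm := hfm.prodMap hgm
  refine (E.wasserstein_le (π := γ.map (Prod.map f g))
    ⟨Measure.isProbabilityMeasure_map hm.aemeasurable, ?_, ?_⟩).trans (lintegral_map_le _ _)
  · rw [Measure.map_map measurable_fst hm, ← hγ.map_fst, Measure.map_map hfm measurable_fst]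
    rfl
  · rw [Measure.map_map measurable_snd hm, ← hγ.map_snd, Measure.map_map hgm measurable_snd]
    rfl

theorem exists_isCoupling_lintegral_le [IsProbabilityMeasure μ] [IsProbabilityMeasure ν]
    (hf : ∀ x, MeasurableSet {f x}) (hg : ∀ y, MeasurableSet {g y})
    (hfin : E.wasserstein (μ.map f) (ν.map g) ≠ ⊤) {ε : ℝ≥0∞} (hε : ε ≠ 0) :
    ∃ γ : Measure (X × Y), IsCoupling γ μ ν ∧
      ∫⁻ p, E.d (f p.1) (g p.2) ∂γ ≤ E.wasserstein (μ.map f) (ν.map g) + ε := by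
  obtain ⟨π, hπ, hlt⟩ : ∃ π, ∃ _ : IsCoupling π (μ.map f) (ν.map g),
      ∫⁻ p, E.d p.1 p.2 ∂π < E.wasserstein (μ.map f) (ν.map g) + ε := by
    have h := ENNReal.lt_add_right hfin hε
    conv_lhs at h => unfold wasserstein
    simpa only [iInf_lt_iff] using h
  obtain ⟨γ, hγ, hle⟩ := exists_isCoupling_of_map hf hg hπ E.d
  exact ⟨γ, hγ, hle.trans hlt.le⟩

end DistSpace

/-! ### The dynamic programming recursion for label distances -/

namespace MeasureMarkovChain
variable {X : Type v} {Y : Type w} {Z : Type u}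
  [Finite X] [MeasurableSpace X] [MeasurableSingletonClass X]
  [Finite Y] [MeasurableSpace Y] [MeasurableSingletonClass Y] [MetricSpace Z]
  (M : MeasureMarkovChain X) (ℓX : X → Z) (N : MeasureMarkovChain Y) (ℓY : Y → Z)

/-- The distance of the depth-`k` Weisfeiler-Lehman labels of two points. -/
noncomputable def wlCost (k : ℕ) (p : X × Y) : ℝ≥0∞ :=
  (DistSpace.iterProb Z k).d (M.wlMap ℓX k p.1).1 (N.wlMap ℓY k p.2).1

/-- By definition the distance of `iterProb Z (k + 1)` is the Wasserstein distance one level below,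
so both halves of the recursion are instances of the results on push-forwards. -/
theorem wlCost_succ_le {k : ℕ} {p : X × Y} {γ : Measure (X × Y)}
    (hγ : IsCoupling γ (M.m p.1) (N.m p.2)) :
    wlCost M ℓX N ℓY (k + 1) p ≤ ∫⁻ q, wlCost M ℓX N ℓY k q ∂γ :=
  (DistSpace.iterProb Z k).wasserstein_map_le hγ

theorem exists_lintegral_wlCost_le (k : ℕ) (p : X × Y) {ε : ℝ≥0∞} (hε : ε ≠ 0) :
    ∃ γ : Measure (X × Y), IsCoupling γ (M.m p.1) (N.m p.2) ∧
      ∫⁻ q, wlCost M ℓX N ℓY k q ∂γ ≤ wlCost M ℓX N ℓY (k + 1) p + ε :=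
  (DistSpace.iterProb Z k).exists_isCoupling_lintegral_le
    (fun x => (M.isLipschitzSeparated_wlMap ℓX k x).measurableSet_singleton)
    (fun y => (N.isLipschitzSeparated_wlMap ℓY k y).measurableSet_singleton)
    ((M.wlMap ℓX (k + 1) p.1).2 (N.wlMap ℓY (k + 1) p.2).1).ne hε

theorem wlDist_ne_top (k : ℕ) : M.wlDist ℓX N ℓY k ≠ ⊤ :=
  ((DistSpace.iterProb Z k).finiteFrom_push _ (fun x => (M.wlMap ℓX k x).2) M.μ _).ne

theorem wlDist_le {k : ℕ} {γ : Measure (X × Y)} (hγ : IsCoupling γ M.μ N.μ) :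
    M.wlDist ℓX N ℓY k ≤ ∫⁻ q, wlCost M ℓX N ℓY k q ∂γ :=
  (DistSpace.iterProb Z k).wasserstein_map_le hγ

theorem exists_lintegral_wlCost_le_wlDist (k : ℕ) {ε : ℝ≥0∞} (hε : ε ≠ 0) :
    ∃ γ : Measure (X × Y), IsCoupling γ M.μ N.μ ∧
      ∫⁻ q, wlCost M ℓX N ℓY k q ∂γ ≤ M.wlDist ℓX N ℓY k + ε :=
  (DistSpace.iterProb Z k).exists_isCoupling_lintegral_le
    (fun x => (M.isLipschitzSeparated_wlMap ℓX k x).measurableSet_singleton)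
    (fun y => (N.isLipschitzSeparated_wlMap ℓY k y).measurableSet_singleton)
    (M.wlDist_ne_top ℓX N ℓY k) hε

end MeasureMarkovChain

/-! ### Lower bound along an arbitrary Markovian coupling -/

/-- Law of total expectation for a variable with finitely many values. -/
theorem lintegral_eq_sum_lintegral_cond {S T Ω : Type*} [Fintype S] [MeasurableSpace S]
    [MeasurableSingletonClass S] [MeasurableSpace T] [MeasurableSpace Ω]
    (P : Measure Ω) [IsProbabilityMeasure P] {ζ : Ω → S} {ζ' : Ω → T} (hζ : Measurable ζ)
    (hζ' : Measurable ζ') {F : T → ℝ≥0∞} (hF : Measurable F) :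
    ∫⁻ ω, F (ζ' ω) ∂P =
      ∑ s, P {ω | ζ ω = s} * ∫⁻ q, F q ∂((cond P {ω | ζ ω = s}).map ζ') := by
  conv_lhs => rw [← sum_meas_smul_cond_fiber hζ P]
  rw [lintegral_finsetSum_measure]
  refine Finset.sum_congr rfl fun s _ => ?_
  rw [lintegral_smul_measure, lintegral_map hF hζ']
  rfl

theorem lintegral_comp_eq_sum {S Ω : Type*} [Fintype S] [MeasurableSpace S]
    [MeasurableSingletonClass S] [MeasurableSpace Ω]
    (P : Measure Ω) {ζ : Ω → S} (hζ : Measurable ζ) (F : S → ℝ≥0∞) :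
    ∫⁻ ω, F (ζ ω) ∂P = ∑ s, P {ω | ζ ω = s} * F s := by
  rw [← lintegral_map (measurable_of_finite F) hζ, lintegral_fintype]
  refine Finset.sum_congr rfl fun s _ => ?_
  rw [Measure.map_apply hζ (MeasurableSet.singleton s), mul_comm]
  rfl

namespace IsMarkovianCoupling
variable {X : Type v} {Y : Type w} {Z : Type u} {Ω : Type t}
  [Finite X] [MeasurableSpace X] [MeasurableSingletonClass X]
  [Finite Y] [MeasurableSpace Y] [MeasurableSingletonClass Y] [MetricSpace Z]
  {M : MeasureMarkovChain X} {N : MeasureMarkovChain Y}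
  [MeasurableSpace Ω] {P : Measure Ω} [IsProbabilityMeasure P] {ξ : ℕ → Ω → X} {η : ℕ → Ω → Y}

/-- Condition on the pair at time `i`: its next-step conditional law is a coupling of the transition
laws, hence a competitor in the recursion. States of probability zero contribute nothing. -/
theorem lintegral_wlCost_succ_le (h : IsMarkovianCoupling M N P ξ η) (ℓX : X → Z) (ℓY : Y → Z)
    (i j : ℕ) :
    ∫⁻ ω, MeasureMarkovChain.wlCost M ℓX N ℓY (j + 1) (ξ i ω, η i ω) ∂P ≤
      ∫⁻ ω, MeasureMarkovChain.wlCost M ℓX N ℓY j (ξ (i + 1) ω, η (i + 1) ω) ∂P := by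
  have := Fintype.ofFinite X
  have := Fintype.ofFinite Y
  have hm : ∀ i, Measurable fun ω => (ξ i ω, η i ω) := fun i =>
    (h.left.measurable i).prodMk (h.right.measurable i)
  rw [lintegral_comp_eq_sum P (hm i),
    lintegral_eq_sum_lintegral_cond P (hm i) (hm (i + 1)) (measurable_of_finite _)]
  refine Finset.sum_le_sum fun s _ => ?_
  by_cases hs : P {ω | (ξ i ω, η i ω) = s} = 0
  · simp [hs]
  · exact mul_le_mul_right (M.wlCost_succ_le ℓX N ℓY (h.transition i s.1 s.2 hs)) _

theorem wlDist_le_lintegral (h : IsMarkovianCoupling M N P ξ η) (ℓX : X → Z) (ℓY : Y → Z)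
    (k : ℕ) : M.wlDist ℓX N ℓY k ≤ ∫⁻ ω, edist (ℓX (ξ k ω)) (ℓY (η k ω)) ∂P := by
  have hm : ∀ i, Measurable fun ω => (ξ i ω, η i ω) := fun i =>
    (h.left.measurable i).prodMk (h.right.measurable i)
  -- The time elapsed and the depth left always add up to `k`.
  have key : ∀ i j, i + j = k → M.wlDist ℓX N ℓY k ≤
      ∫⁻ ω, MeasureMarkovChain.wlCost M ℓX N ℓY j (ξ i ω, η i ω) ∂P := by
    intro i
    induction i with
    | zero =>
      rintro j hj
      obtain rfl : j = k := by omega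
      have hc : IsCoupling (P.map fun ω => (ξ 0 ω, η 0 ω)) M.μ N.μ := by
        refine ⟨Measure.isProbabilityMeasure_map (hm 0).aemeasurable, ?_, ?_⟩
        · rw [Measure.map_map measurable_fst (hm 0)]; exact h.left.law_zero
        · rw [Measure.map_map measurable_snd (hm 0)]; exact h.right.law_zero
      refine (M.wlDist_le ℓX N ℓY hc).trans_eq ?_
      rw [lintegral_map (measurable_of_finite _) (hm 0)]
    | succ i ih =>
      intro j hj
      exact (ih (j + 1) (by omega)).trans (h.lintegral_wlCost_succ_le ℓX ℓY i j)
  exact key k 0 rfl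

end IsMarkovianCoupling

/-! ### Construction of Markovian couplings from one-step couplings -/

/-- Time-inhomogeneous Markov chains on a finite set, in the form used to compute conditional
probabilities given events of the past. The sample space may live in any universe. -/
theorem exists_markov_process {S : Type v} [Finite S] [MeasurableSpace S]
    [MeasurableSingletonClass S] (μ₀ : Measure S) [IsProbabilityMeasure μ₀]
    (K : ℕ → S → Measure S) [∀ i s, IsProbabilityMeasure (K i s)] :
    ∃ (Ω : Type t) (_ : MeasurableSpace Ω) (P : Measure Ω) (_ : IsProbabilityMeasure P)
      (ζ : ℕ → Ω → S), (∀ i, Measurable (ζ i)) ∧ P.map (ζ 0) = μ₀ ∧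
      ∀ (i : ℕ) (A : Set (Finset.Iic i → S)) (T : Set S) (c : ℝ≥0∞),
        (∀ h ∈ A, K i (h ⟨i, by simp⟩) T = c) →
        P ({ω | (fun j : Finset.Iic i => ζ j ω) ∈ A} ∩ {ω | ζ (i + 1) ω ∈ T}) =
          P {ω | (fun j : Finset.Iic i => ζ j ω) ∈ A} * c := by
  obtain ⟨n, ⟨e₀⟩⟩ := Finite.exists_equiv_fin S
  -- A copy of `S` in the universe `t` puts the trajectory space `ℕ → U` there as well.
  let U : Type t := ULift.{t} (Fin n)
  let e : S ≃ U := e₀.trans Equiv.ulift.symm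
  let _ : MeasurableSpace U := ⊤
  have : DiscreteMeasurableSpace U := ⟨fun _ => trivial⟩
  have he : Measurable e := measurable_of_finite e
  have hes : Measurable e.symm := measurable_of_finite e.symm
  have : ∀ i s, IsProbabilityMeasure ((K i s).map e) := fun i s =>
    Measure.isProbabilityMeasure_map he.aemeasurable
  have : IsProbabilityMeasure (μ₀.map e) := Measure.isProbabilityMeasure_map he.aemeasurable
  let κ : (i : ℕ) → Kernel ((j : Finset.Iic i) → (fun _ : ℕ => U) j) U := fun i =>
    { toFun := fun h => (K i (e.symm (h ⟨i, by simp⟩))).map e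
      measurable' := measurable_of_finite _ }
  have : ∀ i, IsMarkovKernel (κ i) := fun i => ⟨fun h => by
    change IsProbabilityMeasure ((K i (e.symm (h ⟨i, by simp⟩))).map e)
    infer_instance⟩
  let P : Measure (ℕ → U) := Kernel.trajMeasure (X := fun _ => U) (μ₀.map e) κ
  have hP : IsProbabilityMeasure P := by
    change IsProbabilityMeasure (Kernel.trajMeasure (X := fun _ => U) (μ₀.map e) κ)
    infer_instance
  refine ⟨ℕ → U, inferInstance, P, hP, fun i ω => e.symm (ω i),
    fun i => hes.comp (measurable_pi_apply i), ?_, ?_⟩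
  · have h0 : P.map (fun ω => ω 0) = μ₀.map e := by
      have hr : P.map (Preorder.frestrictLe (π := fun _ => U) 0) =
          (μ₀.map e).map (MeasurableEquiv.piUnique fun _ : Finset.Iic 0 => U).symm := by
        change (Kernel.trajMeasure (X := fun _ => U) (μ₀.map e) κ).map _ = _
        rw [Kernel.trajMeasure, Measure.map_comp _ _ (by fun_prop), Kernel.traj_map_frestrictLe,
          Kernel.partialTraj_self, Measure.id_comp]
      have hc : (fun ω : ℕ → U => ω 0) =
          (fun h : (Finset.Iic 0 → U) => h ⟨0, by simp⟩) ∘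
            Preorder.frestrictLe (π := fun _ => U) 0 := rfl
      rw [hc, ← Measure.map_map (measurable_pi_apply _) (by fun_prop), hr,
        Measure.map_map (measurable_pi_apply _) (by fun_prop)]
      exact Measure.map_id
    change P.map (e.symm ∘ fun ω => ω 0) = μ₀
    rw [← Measure.map_map hes (measurable_pi_apply 0), h0, Measure.map_map hes he]
    simp
  · intro i A T c hc
    -- The joint law of the history and the next state is the history law composed with `κ i`. On
    -- the rectangle `A' ×ˢ T'` the kernel takes the constant value `c`.
    have hstep := Kernel.map_frestrictLe_trajMeasure_compProd_eq_map_trajMeasure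
      (X := fun _ => U) (μ₀ := μ₀.map e) (κ := κ) (a := i)
    let A' : Set ((j : Finset.Iic i) → (fun _ : ℕ => U) j) := {h | (fun j => e.symm (h j)) ∈ A}
    let T' : Set U := e.symm ⁻¹' T
    have hA' : MeasurableSet A' := MeasurableSet.of_discrete
    have hT' : MeasurableSet T' := MeasurableSet.of_discrete
    have := congrArg (fun ρ => ρ (A' ×ˢ T')) hstep
    simp only at this
    rw [Measure.map_apply (by fun_prop) (hA'.prod hT'), Measure.compProd_apply_prod hA' hT'] at this
    refine this.symm.trans ?_
    have hκ : ∀ h ∈ A', κ i h T' = c := fun h hh => by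
      change (K i (e.symm (h ⟨i, by simp⟩))).map e T' = c
      rw [Measure.map_apply he hT', ← hc _ hh]
      congr 1
      ext s; simp [T']
    rw [setLIntegral_congr_fun hA' hκ, setLIntegral_const,
      Measure.map_apply (by fun_prop) hA', mul_comm]
    rfl

section
variable {X : Type u} {Y : Type v} {Ω : Type t}
  [Finite X] [MeasurableSpace X] [MeasurableSingletonClass X]
  [Finite Y] [MeasurableSpace Y] [MeasurableSingletonClass Y]
  {M : MeasureMarkovChain X} {N : MeasureMarkovChain Y}
  [MeasurableSpace Ω] {P : Measure Ω} [IsProbabilityMeasure P]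

theorem cond_eq_of_measure_inter_eq_mul {A B : Set Ω} {c : ℝ≥0∞} (hA : MeasurableSet A)
    (h : P (A ∩ B) = P A * c) (h0 : P A ≠ 0) : cond P A B = c := by
  rw [cond_apply hA, h, ← mul_assoc, ENNReal.inv_mul_cancel h0 (measure_ne_top _ _), one_mul]

/-- A Markov process whose transition laws are couplings is a Markovian coupling. -/
theorem exists_isMarkovianCoupling (γ₀ : Measure (X × Y)) (hγ₀ : IsCoupling γ₀ M.μ N.μ)
    (K : ℕ → X × Y → Measure (X × Y)) (hK : ∀ i s, IsCoupling (K i s) (M.m s.1) (N.m s.2)) :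
    ∃ (Ω : Type t) (_ : MeasurableSpace Ω) (P : Measure Ω) (_ : IsProbabilityMeasure P)
      (ξ : ℕ → Ω → X) (η : ℕ → Ω → Y), IsMarkovianCoupling M N P ξ η ∧
      P.map (fun ω => (ξ 0 ω, η 0 ω)) = γ₀ ∧
      ∀ i s, P {ω | (ξ i ω, η i ω) = s} ≠ 0 →
        (cond P {ω | (ξ i ω, η i ω) = s}).map (fun ω => (ξ (i + 1) ω, η (i + 1) ω)) = K i s := by
  have hp := hγ₀.isProbabilityMeasure
  have := fun i s => (hK i s).isProbabilityMeasure
  obtain ⟨Ω, mΩ, P, hP, ζ, hζ, h0, hstep⟩ := exists_markov_process.{max u v, t} γ₀ K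
  have hset : ∀ i (B : Set (X × Y)), MeasurableSet {ω | ζ i ω ∈ B} := fun i B =>
    hζ i (MeasurableSet.of_discrete)
  have hist : ∀ (i : ℕ) (x : ℕ → X × Y) (T : Set (X × Y)), P {ω | ∀ j ≤ i, ζ j ω = x j} ≠ 0 →
      cond P {ω | ∀ j ≤ i, ζ j ω = x j} {ω | ζ (i + 1) ω ∈ T} = K i (x i) T := by
    intro i x T hx
    have hm : MeasurableSet {ω | ∀ j ≤ i, ζ j ω = x j} := by
      simp only [ofPred_forall]
      exact MeasurableSet.iInter fun j => MeasurableSet.iInter fun _ => hset j {x j}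
    have := hstep i {h | ∀ j, h j = x j} T (K i (x i) T) fun h hh => by rw [hh]
    have he : {ω | (fun j : Finset.Iic i => ζ j ω) ∈ {h : Finset.Iic i → X × Y | ∀ j, h j = x j}} =
        {ω | ∀ j ≤ i, ζ j ω = x j} := by
      ext ω; simp
    rw [he] at this
    exact cond_eq_of_measure_inter_eq_mul hm this hx
  -- The event `B` may fix only one coordinate of the pair. The marginals of `K i s` depend on one
  -- coordinate of `s` each, so this also yields the transition probabilities of the two single
  -- processes.
  have now : ∀ (i : ℕ) (B T : Set (X × Y)) (c : ℝ≥0∞), (∀ s ∈ B, K i s T = c) →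
      P {ω | ζ i ω ∈ B} ≠ 0 → cond P {ω | ζ i ω ∈ B} {ω | ζ (i + 1) ω ∈ T} = c :=
    fun i B T c hc h0 => cond_eq_of_measure_inter_eq_mul (hset i B)
      (hstep i {h | h ⟨i, by simp⟩ ∈ B} T c fun h hh => hc _ hh) h0
  have htrans : ∀ i s, P {ω | ζ i ω = s} ≠ 0 →
      (cond P {ω | ζ i ω = s}).map (ζ (i + 1)) = K i s := fun i s hs => by
    refine Measure.ext fun T hT => ?_
    rw [Measure.map_apply (hζ (i + 1)) hT]
    exact now i {s} T _ (fun s' hs' => by rw [hs']) hs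
  refine ⟨Ω, mΩ, P, hP, fun i ω => (ζ i ω).1, fun i ω => (ζ i ω).2, ⟨?_, ?_, ?_, ?_⟩, h0, htrans⟩
  · refine ⟨fun i => measurable_fst.comp (hζ i), ?_, fun i x x' hx => ?_⟩
    · rw [← hγ₀.map_fst, ← h0, Measure.map_map measurable_fst (hζ 0)]
      rfl
    · refine now i (Prod.fst ⁻¹' {x}) (Prod.fst ⁻¹' {x'}) _ (fun s hs => ?_) hx
      rw [← Measure.map_apply measurable_fst (MeasurableSet.singleton x'), (hK i s).map_fst,
        show s.1 = x from hs]
  · refine ⟨fun i => measurable_snd.comp (hζ i), ?_, fun i y y' hy => ?_⟩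
    · rw [← hγ₀.map_snd, ← h0, Measure.map_map measurable_snd (hζ 0)]
      rfl
    · refine now i (Prod.snd ⁻¹' {y}) (Prod.snd ⁻¹' {y'}) _ (fun s hs => ?_) hy
      rw [← Measure.map_apply measurable_snd (MeasurableSet.singleton y'), (hK i s).map_snd,
        show s.2 = y from hs]
  · intro i x y hxy
    have hne : P {ω | ζ i ω = (x i, y i)} ≠ 0 := fun h =>
      hxy (measure_mono_null (fun ω hω => hω i le_rfl) h)
    exact (hist i (fun j => (x j, y j)) {(x (i + 1), y (i + 1))} hxy).trans
      (now i {(x i, y i)} {(x (i + 1), y (i + 1))} _ (fun s' hs' => by rw [hs']) hne).symm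
  · intro i x y hxy
    have h := htrans i (x, y) hxy
    change IsCoupling ((cond P {ω | ζ i ω = (x, y)}).map (ζ (i + 1))) _ _
    rw [h]
    exact hK i (x, y)

end

/-! ### Upper bound and conclusion -/

namespace MeasureMarkovChain
variable {X : Type u} {Y : Type v} {Z : Type w}
    [Finite X] [MeasurableSpace X] [MeasurableSingletonClass X]
    [Finite Y] [MeasurableSpace Y] [MeasurableSingletonClass Y] [MetricSpace Z]
    (M : MeasureMarkovChain X) (ℓX : X → Z) (N : MeasureMarkovChain Y) (ℓY : Y → Z)

/-- Markovian couplings with almost optimal transition laws. -/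
theorem exists_isMarkovianCoupling_lintegral_le (k : ℕ) {ε : ℝ≥0∞} (hε : ε ≠ 0) :
    ∃ (Ω : Type t) (_ : MeasurableSpace Ω) (P : Measure Ω) (_ : IsProbabilityMeasure P)
      (ξ : ℕ → Ω → X) (η : ℕ → Ω → Y), IsMarkovianCoupling M N P ξ η ∧
      ∫⁻ ω, edist (ℓX (ξ k ω)) (ℓY (η k ω)) ∂P ≤ M.wlDist ℓX N ℓY k + (k + 1) * ε := by
  have := Fintype.ofFinite X
  have := Fintype.ofFinite Y
  obtain ⟨γ₀, hγ₀, hle₀⟩ := M.exists_lintegral_wlCost_le_wlDist ℓX N ℓY k hε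
  choose γ hγ hle using fun j p => M.exists_lintegral_wlCost_le ℓX N ℓY j p hε
  -- At a time `i < k` the remaining depth is `k - i`, so the transition is nearly optimal for the
  -- cost of depth `k - 1 - i`. From time `k` on, truncated subtraction gives `γ 0`; there any
  -- coupling would do.
  obtain ⟨Ω, mΩ, P, hP, ξ, η, hc, h0, htrans⟩ := exists_isMarkovianCoupling.{u, v, t} γ₀ hγ₀
    (fun i => γ (k - 1 - i)) fun i s => hγ _ s
  refine ⟨Ω, mΩ, P, hP, ξ, η, hc, ?_⟩
  have hm : ∀ i, Measurable fun ω => (ξ i ω, η i ω) := fun i =>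
    (hc.left.measurable i).prodMk (hc.right.measurable i)
  -- One `ε` is lost in the initial coupling and one in each of the `i` transitions.
  have key : ∀ i j, i + j = k → ∫⁻ ω, wlCost M ℓX N ℓY j (ξ i ω, η i ω) ∂P ≤
      M.wlDist ℓX N ℓY k + (i + 1) * ε := by
    intro i
    induction i with
    | zero =>
      intro j hj
      obtain rfl : j = k := by omega
      rw [← lintegral_map (measurable_of_finite _) (hm 0), h0]
      simpa using hle₀
    | succ i ih =>
      intro j hj
      have hstep : ∫⁻ ω, wlCost M ℓX N ℓY j (ξ (i + 1) ω, η (i + 1) ω) ∂P ≤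
          ∫⁻ ω, (wlCost M ℓX N ℓY (j + 1) (ξ i ω, η i ω) + ε) ∂P := by
        rw [lintegral_comp_eq_sum P (hm i) (fun s => wlCost M ℓX N ℓY (j + 1) s + ε),
          lintegral_eq_sum_lintegral_cond P (hm i) (hm (i + 1)) (measurable_of_finite _)]
        refine Finset.sum_le_sum fun s _ => ?_
        by_cases hs : P {ω | (ξ i ω, η i ω) = s} = 0
        · simp [hs]
        · rw [htrans i s hs, show k - 1 - i = j by omega]
          exact mul_le_mul_right (hle j s) _
      refine hstep.trans ?_
      rw [lintegral_add_right _ measurable_const, lintegral_const, measure_univ, mul_one]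
      refine (add_le_add_left (ih (j + 1) (by omega)) ε).trans_eq ?_
      push_cast
      ring
  exact key k 0 rfl

end MeasureMarkovChain

/-- The empty set has no greatest lower bound in ℝ, so `IsGLB` here includes the existence of
Markovian couplings. -/
theorem mainTheorem11 {X : Type u} {Y : Type v} {Z : Type w}
    [Finite X] [MeasurableSpace X] [MeasurableSingletonClass X]
    [Finite Y] [MeasurableSpace Y] [MeasurableSingletonClass Y] [MetricSpace Z]
    (M : MeasureMarkovChain X) (ℓX : X → Z) (N : MeasureMarkovChain Y) (ℓY : Y → Z) (k : ℕ) :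
    M.wlDist ℓX N ℓY k ≠ ⊤ ∧
    IsGLB {r : ℝ | ∃ (Ω : Type t) (_ : MeasurableSpace Ω) (P : Measure Ω)
        (_ : IsProbabilityMeasure P) (ξ : ℕ → Ω → X) (η : ℕ → Ω → Y),
        IsMarkovianCoupling M N P ξ η ∧ r = ∫ ω, dist (ℓX (ξ k ω)) (ℓY (η k ω)) ∂P}
      (M.wlDist ℓX N ℓY k).toReal := by
  have hW := M.wlDist_ne_top ℓX N ℓY k
  -- The cost takes finitely many values, so it is integrable and the real expectation agrees with
  -- the extended one.
  have hint : ∀ {Ω : Type t} [MeasurableSpace Ω] {P : Measure Ω} [IsProbabilityMeasure P]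
      {ξ : ℕ → Ω → X} {η : ℕ → Ω → Y}, IsMarkovianCoupling M N P ξ η →
      ENNReal.ofReal (∫ ω, dist (ℓX (ξ k ω)) (ℓY (η k ω)) ∂P) =
        ∫⁻ ω, edist (ℓX (ξ k ω)) (ℓY (η k ω)) ∂P := by
    intro Ω _ P _ ξ η h
    have hm : Measurable fun ω => (ξ k ω, η k ω) :=
      (h.left.measurable k).prodMk (h.right.measurable k)
    let F : X × Y → ℝ := fun p => dist (ℓX p.1) (ℓY p.2)
    have hi : Integrable (fun ω => F (ξ k ω, η k ω)) P :=
      Integrable.comp_measurable (f := fun ω => (ξ k ω, η k ω)) (g := F) .of_finite hm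
    rw [ofReal_integral_eq_lintegral_ofReal hi (Filter.Eventually.of_forall fun _ => dist_nonneg)]
    simp only [edist_dist, F]
  refine ⟨hW, ?_, fun b hb => ?_⟩
  · rintro _ ⟨Ω, _, P, _, ξ, η, h, rfl⟩
    refine ENNReal.toReal_le_of_le_ofReal (integral_nonneg fun _ => dist_nonneg) ?_
    rw [hint h]
    exact h.wlDist_le_lintegral ℓX ℓY k
  · refine le_of_forall_pos_le_add fun δ hδ => ?_
    have hk : (0 : ℝ) < k + 1 := by positivity
    obtain ⟨Ω, mΩ, P, hP, ξ, η, h, hle⟩ :=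
      M.exists_isMarkovianCoupling_lintegral_le.{u, v, w, t} ℓX N ℓY k
        (ε := ENNReal.ofReal (δ / (k + 1))) (by simp; positivity)
    refine (hb ⟨Ω, mΩ, P, hP, ξ, η, h, rfl⟩).trans ?_
    have hε : ((k : ℝ≥0∞) + 1) * ENNReal.ofReal (δ / (k + 1)) = ENNReal.ofReal δ := by
      rw [← ENNReal.ofReal_natCast, ← ENNReal.ofReal_one,
        ← ENNReal.ofReal_add (by positivity) (by positivity), ← ENNReal.ofReal_mul hk.le,
        mul_div_cancel₀ _ hk.ne']
    rw [hε, ← hint h, ← ENNReal.ofReal_toReal hW,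
      ← ENNReal.ofReal_add ENNReal.toReal_nonneg hδ.le,
      ENNReal.ofReal_le_ofReal_iff (add_nonneg ENNReal.toReal_nonneg hδ.le)] at hle
    exact hle
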